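/- Let $\mu$ be a probability measure on a measurable space and let $1\le q<p<\infty$. Let $E$ be a closed linear subspace of the (real or complex) space $L_p(\mu)$. For $1\le r\le p$ we regard $E$ as a subspace of $L_r(\mu)$ through the inclusion $L_p(\mu)\subseteq L_r(\mu)$. We say that the norms $\|\cdot\|_{L_r}$ and $\|\cdot\|_{L_p}$ are equivalent on $E$ if there are constants $c,C>0$ with $c\|f\|_{L_r}\le\|f\|_{L_p}\le C\|f\|_{L_r}$ for all $f\in E$, and that $E$ does stable phase retrieval in $L_r(\mu)$ if there is a constant $C>0$ such that $$\inf_{|\lambda|=1}\|f-\lambda g\|_{L_r}\le C\,\big\||f|-|g|\big\|_{L_r}\qquad\text{for all } f,g\in E,$$ where $\lambda$ ranges over the scalars of modulus one. Assume that $\|\cdot\|_{L_p}$ and $\|\cdot\|_{L_q}$ are equivalent on $E$ and that $E$ does stable phase retrieval in $L_q(\mu)$. Then for every $1\le r\le p$ the norms $\|\cdot\|_{L_r}$ and $\|\cdot\|_{L_p}$ are equivalent on $E$, and $E$ does stable phase retrieval in $L_r(\mu)$. -/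

import Mathlib

open MeasureTheory
open scoped ENNReal

namespace StablePhaseRetrieval

noncomputable section

/-- The modulus `|f|` of a (real or complex) element of `L_r(μ)`, as an element of real `L_r(μ)`;
it is the class of the function `x ↦ ‖f x‖`. -/
def modulus {𝕜 : Type*} [RCLike 𝕜] {Ω : Type*} [MeasurableSpace Ω] {μ : Measure Ω} {r : ℝ≥0∞}
    (f : Lp 𝕜 r μ) : Lp ℝ r μ :=
  (Lp.memLp f).norm.toLp (fun x => ‖f x‖)

/-- A subspace `E` of `L_r(μ)` does `C`-stable phase retrieval (in `L_r(μ)`):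
`inf_{|z| = 1} ‖f - z g‖_r ≤ C ‖|f| - |g|‖_r` for all `f, g ∈ E`. -/
def DoesStablePhaseRetrievalWith {𝕜 : Type*} [RCLike 𝕜] {Ω : Type*} [MeasurableSpace Ω]
    {μ : Measure Ω} {r : ℝ≥0∞} (C : ℝ) (E : Submodule 𝕜 (Lp 𝕜 r μ)) : Prop :=
  ∀ f ∈ E, ∀ g ∈ E,
    (⨅ z : Metric.sphere (0 : 𝕜) 1, ‖f - (z : 𝕜) • g‖) ≤ C * ‖modulus f - modulus g‖

/-- A subspace `E` of `L_r(μ)` does stable phase retrieval (in `L_r(μ)`). -/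
def DoesSPR {𝕜 : Type*} [RCLike 𝕜] {Ω : Type*} [MeasurableSpace Ω]
    {μ : Measure Ω} {r : ℝ≥0∞} (E : Submodule 𝕜 (Lp 𝕜 r μ)) : Prop :=
  ∃ C : ℝ, 0 < C ∧ DoesStablePhaseRetrievalWith C E

/-- The canonical inclusion `L_p(μ) ⊆ L_r(μ)` for `r ≤ p` and a finite measure `μ`; it does not
change the underlying almost-everywhere class of functions. -/
def inclusion (𝕜 : Type*) [RCLike 𝕜] {Ω : Type*} [MeasurableSpace Ω] (μ : Measure Ω)
    [IsFiniteMeasure μ] {r p : ℝ≥0∞} (hrp : r ≤ p) : Lp 𝕜 p μ →ₗ[𝕜] Lp 𝕜 r μ where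
  toFun f := ⟨(f : Ω →ₘ[μ] 𝕜), Lp.antitone hrp f.2⟩
  map_add' _ _ := rfl
  map_smul' _ _ := rfl

/-- The `L_r` and `L_p` norms are equivalent on the subspace `E` of `L_p(μ)`, where `r ≤ p`. -/
def NormsEquivalentOn {𝕜 : Type*} [RCLike 𝕜] {Ω : Type*} [MeasurableSpace Ω] {μ : Measure Ω}
    [IsFiniteMeasure μ] {r p : ℝ≥0∞} (hrp : r ≤ p) (E : Submodule 𝕜 (Lp 𝕜 p μ)) : Prop :=
  ∃ c C : ℝ, 0 < c ∧ 0 < C ∧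
    ∀ f ∈ E, c * ‖inclusion 𝕜 μ hrp f‖ ≤ ‖f‖ ∧ ‖f‖ ≤ C * ‖inclusion 𝕜 μ hrp f‖

end

end StablePhaseRetrieval

namespace StablePhaseRetrieval

section Inclusion

variable {𝕜 : Type*} [RCLike 𝕜] {Ω : Type*} [MeasurableSpace Ω] {μ : Measure Ω}

/-! A reverse Hölder bound `‖h‖_p ≤ K ‖h‖_q` for a single function `h` improves, by interpolating
`L_q` between `L_1` and `L_p`, to `‖h‖_p ≤ K' ‖h‖_1`, hence to any `L_r` with `1 ≤ r ≤ p`. Applied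
to `f ∈ E` this gives the norm equivalence. For phase retrieval, apply it to `d = |f| - |g|`, which
need not lie in `E`: pointwise `|d| ≤ |f - z g|`, so norm equivalence and stability in `L_q` give
`‖d‖_p ≤ inf ‖f - z g‖_p ≤ B inf ‖f - z g‖_q ≤ B C ‖d‖_q`. -/

theorem norm_inclusion_le [IsProbabilityMeasure μ] {r p : ℝ≥0∞} (hrp : r ≤ p) (f : Lp 𝕜 p μ) :
    ‖inclusion 𝕜 μ hrp f‖ ≤ ‖f‖ :=
  ENNReal.toReal_mono (Lp.eLpNorm_ne_top f)
    (eLpNorm_le_eLpNorm_of_exponent_le hrp (Lp.aestronglyMeasurable f))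

theorem modulus_inclusion [IsFiniteMeasure μ] {r p : ℝ≥0∞} (hrp : r ≤ p) (f : Lp 𝕜 p μ) :
    modulus (inclusion 𝕜 μ hrp f) = inclusion ℝ μ hrp (modulus f) := rfl

theorem norm_modulus_sub_modulus_le {p : ℝ≥0∞} (f g : Lp 𝕜 p μ)
    {z : 𝕜} (hz : ‖z‖ = 1) : ‖modulus f - modulus g‖ ≤ ‖f - z • g‖ := by
  refine Lp.norm_le_norm_of_ae_le ?_
  filter_upwards [Lp.coeFn_sub (modulus f) (modulus g), Lp.coeFn_sub f (z • g),
    Lp.coeFn_smul z g, (Lp.memLp f).norm.coeFn_toLp, (Lp.memLp g).norm.coeFn_toLp]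
    with x h₁ h₂ h₃ h₄ h₅
  have h₄' : modulus f x = ‖f x‖ := h₄
  have h₅' : modulus g x = ‖z • g x‖ := by rw [norm_smul, hz, one_mul]; exact h₅
  rw [h₁, h₂, Pi.sub_apply, Pi.sub_apply, h₃, Pi.smul_apply, h₄', h₅', Real.norm_eq_abs]
  exact abs_norm_sub_norm_le _ _

end Inclusion

section Interpolation

variable {Ω F : Type*} [MeasurableSpace Ω] {μ : Measure Ω} [NormedAddCommGroup F]

/-- Interpolation of the `L_q` norm between the `L_1` and the `L_p` norm, without roots. -/
theorem eLpNorm_rpow_le_eLpNorm_one_mul_eLpNorm {p q : ℝ} (hq : 1 ≤ q) (hqp : q < p) {f : Ω → F}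
    (hf : AEStronglyMeasurable f μ) :
    eLpNorm f (ENNReal.ofReal q) μ ^ q ≤
      eLpNorm f 1 μ ^ ((p - q) / (p - 1)) *
        eLpNorm f (ENNReal.ofReal p) μ ^ (q - (p - q) / (p - 1)) := by
  have hp1 : 0 < p - 1 := by linarith
  have hpow (s : ℝ) (hs : 0 < s) :
      eLpNorm f (ENNReal.ofReal s) μ = (∫⁻ x, ‖f x‖ₑ ^ s ∂μ) ^ (1 / s) := by
    rw [eLpNorm_eq_lintegral_rpow_enorm_toReal (by simpa using hs) ENNReal.ofReal_ne_top,
      ENNReal.toReal_ofReal hs.le]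
  rw [hpow q (by linarith), hpow p (by linarith), eLpNorm_one_eq_lintegral_enorm,
    ← ENNReal.rpow_mul, ← ENNReal.rpow_mul, one_div_mul_cancel (by linarith), ENNReal.rpow_one]
  have ha : 0 ≤ (p - q) / (p - 1) := div_nonneg (by linarith) hp1.le
  have hb : 0 ≤ (q - 1) / (p - 1) := div_nonneg (by linarith) hp1.le
  have hexp : 1 / p * (q - (p - q) / (p - 1)) = (q - 1) / (p - 1) := by
    have : p ≠ 0 := by linarith
    field_simp
    ring
  have hsum : (p - q) / (p - 1) + p * ((q - 1) / (p - 1)) = q := by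
    field_simp
    ring
  rw [hexp]
  -- Hölder for `|f| ^ q = |f| ^ a * (|f| ^ p) ^ b`, where `a = (p - q) / (p - 1)`, `b = (q - 1) /
  -- (p - 1)` and `a + b = 1`.
  refine le_trans (le_of_eq ?_) (ENNReal.lintegral_mul_norm_pow_le hf.enorm
    (hf.enorm.pow_const p) ha hb (by field_simp; ring))
  refine lintegral_congr fun x => ?_
  rw [← ENNReal.rpow_mul, ← ENNReal.rpow_add_of_nonneg _ _ ha (mul_nonneg (by linarith) hb), hsum]

/-- A reverse Hölder inequality between `L_p` and `L_q` with `q < p` improves to one between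
`L_p` and `L_1`. -/
theorem eLpNorm_le_mul_eLpNorm_one {p q : ℝ} (hq : 1 ≤ q) (hqp : q < p) {f : Ω → F}
    (hf : MemLp f (ENNReal.ofReal p) μ) {K : ℝ≥0∞}
    (hK : eLpNorm f (ENNReal.ofReal p) μ ≤ K * eLpNorm f (ENNReal.ofReal q) μ) :
    eLpNorm f (ENNReal.ofReal p) μ ≤ K ^ (q / ((p - q) / (p - 1))) * eLpNorm f 1 μ := by
  set a := (p - q) / (p - 1) with ha_def
  have ha : 0 < a := div_pos (by linarith) (by linarith)
  set X := eLpNorm f (ENNReal.ofReal p) μ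
  rcases eq_or_ne X 0 with h0 | h0
  · simp [h0]
  have htop : X ≠ ∞ := hf.eLpNorm_ne_top
  -- Splitting `X ^ q` lets the factor `X ^ (q - a)` from interpolation cancel, since `X` is neither
  -- `0` nor `∞`.
  have key : X ^ a * X ^ (q - a) ≤ K ^ q * eLpNorm f 1 μ ^ a * X ^ (q - a) := by
    rw [← ENNReal.rpow_add _ _ h0 htop, add_sub_cancel]
    calc X ^ q ≤ (K * eLpNorm f (ENNReal.ofReal q) μ) ^ q :=
          ENNReal.rpow_le_rpow hK (by linarith)
      _ = K ^ q * eLpNorm f (ENNReal.ofReal q) μ ^ q :=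
          ENNReal.mul_rpow_of_nonneg _ _ (by linarith)
      _ ≤ K ^ q * (eLpNorm f 1 μ ^ a * X ^ (q - a)) := by
          gcongr
          exact eLpNorm_rpow_le_eLpNorm_one_mul_eLpNorm hq hqp hf.1
      _ = _ := (mul_assoc _ _ _).symm
  have key' : X ^ a ≤ K ^ q * eLpNorm f 1 μ ^ a :=
    (ENNReal.mul_le_mul_iff_left (ENNReal.rpow_pos (pos_iff_ne_zero.2 h0) htop).ne'
      (ENNReal.rpow_ne_top_of_ne_zero h0 htop)).1 key
  rw [← ENNReal.rpow_le_rpow_iff ha, ENNReal.mul_rpow_of_nonneg _ _ ha.le, ← ENNReal.rpow_mul,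
    div_mul_cancel₀ _ ha.ne']
  exact key'

end Interpolation

variable {𝕜 : Type*} [RCLike 𝕜] {Ω : Type*} [MeasurableSpace Ω] {μ : Measure Ω}
  [IsProbabilityMeasure μ]

/-- The hypothesis concerns one function rather than a subspace, so that it also covers differences
of moduli; `K'` is uniform in the function and in `r`. -/
theorem exists_norm_le_mul_norm_inclusion {p q : ℝ≥0∞} (hq : 1 ≤ q) (hqp : q < p) (hp : p < ∞)
    (K : ℝ) : ∃ K' : ℝ, 0 < K' ∧ ∀ f : Lp 𝕜 p μ, ‖f‖ ≤ K * ‖inclusion 𝕜 μ hqp.le f‖ →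
      ∀ (r : ℝ≥0∞) (_ : 1 ≤ r) (hrp : r ≤ p), ‖f‖ ≤ K' * ‖inclusion 𝕜 μ hrp f‖ := by
  have hqt : q ≠ ∞ := (hqp.trans hp).ne
  have hq' : 1 ≤ q.toReal := by simpa using ENNReal.toReal_mono hqt hq
  have hqp' : q.toReal < p.toReal := ENNReal.toReal_strict_mono hp.ne hqp
  set e := q.toReal / ((p.toReal - q.toReal) / (p.toReal - 1))
  have he : 0 ≤ e :=
    div_nonneg (by linarith) (div_nonneg (by linarith) (by linarith))
  -- `K` may be any real; the maximum with `1` makes the constant positive.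
  refine ⟨(max K 1) ^ e, by positivity, fun f hf r hr hrp => ?_⟩
  have hfin {s : ℝ≥0∞} (hs : s ≤ p) : eLpNorm f s μ ≠ ∞ := Lp.eLpNorm_ne_top (inclusion 𝕜 μ hs f)
  have hK : eLpNorm f p μ ≤ ENNReal.ofReal (max K 1) * eLpNorm f q μ := by
    rw [← ENNReal.toReal_le_toReal (hfin le_rfl)
      (ENNReal.mul_ne_top ENNReal.ofReal_ne_top (hfin hqp.le)), ENNReal.toReal_mul,
      ENNReal.toReal_ofReal (by positivity)]
    exact hf.trans (mul_le_mul_of_nonneg_right (le_max_left _ _) ENNReal.toReal_nonneg)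
  have hmem : MemLp f (ENNReal.ofReal p.toReal) μ :=
    (ENNReal.ofReal_toReal hp.ne).symm ▸ (⟨Lp.aestronglyMeasurable f, Lp.eLpNorm_lt_top f⟩ :
      MemLp (f : Ω →ₘ[μ] 𝕜) p μ)
  have h₁ := eLpNorm_le_mul_eLpNorm_one hq' hqp' hmem (K := ENNReal.ofReal (max K 1))
    (by rwa [ENNReal.ofReal_toReal hp.ne, ENNReal.ofReal_toReal hqt])
  rw [ENNReal.ofReal_toReal hp.ne] at h₁
  have h₂ : eLpNorm f p μ ≤ ENNReal.ofReal (max K 1) ^ e * eLpNorm f r μ :=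
    h₁.trans (mul_le_mul_right
      (eLpNorm_le_eLpNorm_of_exponent_le hr (Lp.aestronglyMeasurable f)) _)
  have h₃ := ENNReal.toReal_mono (ENNReal.mul_ne_top
    (ENNReal.rpow_ne_top_of_nonneg he ENNReal.ofReal_ne_top)
    (hfin hrp)) h₂
  rwa [ENNReal.toReal_mul, ← ENNReal.toReal_rpow, ENNReal.toReal_ofReal (by positivity)] at h₃

end StablePhaseRetrieval

open StablePhaseRetrieval in
theorem theorem5p4 {𝕜 : Type*} [RCLike 𝕜] {Ω : Type*} [MeasurableSpace Ω] (μ : Measure Ω)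
    [IsProbabilityMeasure μ] (p q : ℝ≥0∞) [Fact (1 ≤ p)] (hq : 1 ≤ q) (hqp : q < p)
    (hp : p < ∞) (E : Submodule 𝕜 (Lp 𝕜 p μ)) (hE : IsClosed (E : Set (Lp 𝕜 p μ)))
    (hnorm : StablePhaseRetrieval.NormsEquivalentOn hqp.le E)
    (hspr : StablePhaseRetrieval.DoesSPR
      (E.map (StablePhaseRetrieval.inclusion 𝕜 μ hqp.le))) :
    ∀ (r : ℝ≥0∞) (_ : 1 ≤ r) (hrp : r ≤ p),
      StablePhaseRetrieval.NormsEquivalentOn hrp E ∧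
      StablePhaseRetrieval.DoesSPR (E.map (StablePhaseRetrieval.inclusion 𝕜 μ hrp)) := by
  intro r hr hrp
  obtain ⟨_, B, _, hB, hnorm⟩ := hnorm
  obtain ⟨C, hC, hspr⟩ := hspr
  refine ⟨?_, ?_⟩
  · obtain ⟨K, hK, h⟩ := exists_norm_le_mul_norm_inclusion (𝕜 := 𝕜) (μ := μ) hq hqp hp B
    exact ⟨1, K, one_pos, hK, fun f hf => ⟨by simpa using norm_inclusion_le hrp f,
      h f (hnorm f hf).2 r hr hrp⟩⟩
  obtain ⟨K, hK, h⟩ := exists_norm_le_mul_norm_inclusion (𝕜 := ℝ) (μ := μ) hq hqp hp (B * C)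
  refine ⟨B * C * K, by positivity, ?_⟩
  rintro _ ⟨f, hf, rfl⟩ _ ⟨g, hg, rfl⟩
  have hinf := hspr _ (Submodule.mem_map_of_mem hf) _ (Submodule.mem_map_of_mem hg)
  simp only [modulus_inclusion, ← map_sub, ← map_smul] at hinf ⊢
  set d := modulus f - modulus g
  have : Nonempty (Metric.sphere (0 : 𝕜) 1) := ⟨⟨1, by simp⟩⟩
  have hfg (z : Metric.sphere (0 : 𝕜) 1) :
      ‖f - (z : 𝕜) • g‖ ≤ B * ‖inclusion 𝕜 μ hqp.le (f - (z : 𝕜) • g)‖ :=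
    (hnorm _ (E.sub_mem hf (E.smul_mem _ hg))).2
  -- The reverse Hölder bound for `d`, from taking the infimum over `z`.
  have hd : ‖d‖ ≤ B * C * ‖inclusion ℝ μ hqp.le d‖ := by
    rw [mul_assoc]
    refine le_trans ?_ (mul_le_mul_of_nonneg_left hinf hB.le)
    rw [Real.mul_iInf_of_nonneg hB.le]
    exact le_ciInf fun z =>
      (norm_modulus_sub_modulus_le f g (mem_sphere_zero_iff_norm.1 z.2)).trans (hfg z)
  calc (⨅ z : Metric.sphere (0 : 𝕜) 1, ‖inclusion 𝕜 μ hrp (f - (z : 𝕜) • g)‖)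
      ≤ ⨅ z : Metric.sphere (0 : 𝕜) 1, B * ‖inclusion 𝕜 μ hqp.le (f - (z : 𝕜) • g)‖ :=
        ciInf_mono ⟨0, by rintro _ ⟨z, rfl⟩; exact ENNReal.toReal_nonneg⟩ fun z =>
          (norm_inclusion_le hrp _).trans (hfg z)
    _ = B * ⨅ z : Metric.sphere (0 : 𝕜) 1, ‖inclusion 𝕜 μ hqp.le (f - (z : 𝕜) • g)‖ :=
        (Real.mul_iInf_of_nonneg hB.le _).symm
    _ ≤ B * (C * ‖inclusion ℝ μ hqp.le d‖) := mul_le_mul_of_nonneg_left hinf hB.le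
    _ = B * C * ‖inclusion ℝ μ hqp.le d‖ := (mul_assoc _ _ _).symm
    _ ≤ B * C * ‖d‖ := mul_le_mul_of_nonneg_left (norm_inclusion_le _ d) (by positivity)
    _ ≤ B * C * (K * ‖inclusion ℝ μ hrp d‖) :=
        mul_le_mul_of_nonneg_left (h d hd r hr hrp) (by positivity)
    _ = B * C * K * ‖inclusion ℝ μ hrp d‖ := (mul_assoc _ _ _).symm
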